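/- Proposition. All graphs are finite and simple. For vertices $y,z$ of a graph $\Delta$, let $\Delta(y,z)$ denote the set of common neighbours of $y$ and $z$. For natural numbers $q\ge 2$ and $n$, put $[n]_q := 1+q+\cdots+q^{n-1}=\frac{q^n-1}{q-1}$, and let $$\chi(q)=\begin{cases}9 & \text{if } q=2,\\ 8 & \text{if } q=3,\\ 7 & \text{if } q\in\{4,5,6\},\\ 6 & \text{if } q\ge 7.\end{cases}$$ The $(s\times t)$-grid is the Cartesian product of the complete graphs on $s$ and $t$ vertices. The $q$-clique extension of a graph $G$ is the graph with vertex set $V(G)\times\{1,\dots,q\}$ in which two distinct vertices are adjacent if and only if their first coordinates are equal or adjacent in $G$. Two graphs are cospectral if their adjacency matrices have the same eigenvalues with the same multiplicities. Let $q,D$ be natural numbers with $q\ge 2$, and let $\Delta$ be a graph satisfying the following conditions. (1) $|\Delta(y,z)|\equiv q-2 \pmod{[D-1]_q}$ for every pair $y,z$ of adjacent vertices of $\Delta$. (2) $|\Delta(y,z)|=2q$ for every pair $y,z$ of distinct non-adjacent vertices of $\Delta$. (3) $\Delta$ is cospectral to the $q$-clique extension of the $([D]_q\times[D]_q)$-grid.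 If $D\ge\chi(q)$, then $\Delta$ is isomorphic to the $q$-clique extension of the $([D]_q\times[D]_q)$-grid. -/

import Mathlib

/-- The Gaussian binomial coefficient `[n choose 1]_q = 1 + q + ⋯ + q ^ (n - 1)`. -/
def gaussNumber (q n : ℕ) : ℕ := ∑ i ∈ Finset.range n, q ^ i

/-- The bound `χ(q)`, meant for `q ≥ 2`: it is `9` for `q = 2`, `8` for `q = 3`, `7` for
`q = 4, 5, 6`, and `6` for `q ≥ 7`. -/
def chiBound (q : ℕ) : ℕ :=
  if q = 2 then 9 else if q = 3 then 8 else if q ≤ 6 then 7 else 6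

/-- The `s × t` grid: the Cartesian product of the complete graphs on `s` and `t` vertices. -/
def gridGraph (s t : ℕ) : SimpleGraph (Fin s × Fin t) :=
  SimpleGraph.boxProd (⊤ : SimpleGraph (Fin s)) (⊤ : SimpleGraph (Fin t))

/-- The `q`-clique extension of a graph: every vertex is replaced by `q` vertices (the fibre of the
first projection), and two distinct vertices are adjacent if and only if their projections are
equal or adjacent. -/
def cliqueExtension {V : Type*} (q : ℕ) (G : SimpleGraph V) : SimpleGraph (V × Fin q) where
  Adj u w := u ≠ w ∧ (u.1 = w.1 ∨ G.Adj u.1 w.1)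
  symm := ⟨fun _ _ h => ⟨h.1.symm, h.2.imp Eq.symm (fun e => e.symm)⟩⟩
  loopless := ⟨fun _ h => h.1 rfl⟩

open scoped Classical in
/-- The spectrum of a finite graph: the multiset of the eigenvalues of its adjacency matrix, with
multiplicities. (The matrix is real symmetric, so its characteristic polynomial splits over `ℝ`, and
algebraic and geometric multiplicities agree.) -/
noncomputable def graphSpectrum {V : Type*} [Fintype V] (G : SimpleGraph V) : Multiset ℝ :=
  (G.adjMatrix ℝ).charpoly.roots

/-- Two finite graphs are cospectral if they have the same spectrum. -/
def IsCospectral {V W : Type*} [Fintype V] [Fintype W] (G : SimpleGraph V) (H : SimpleGraph W) :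
    Prop :=
  graphSpectrum G = graphSpectrum H

/-!
Write `n = [D]_q` and `M = [D - 1]_q`, so `n = q * M + 1`, and let `H` be the adjacency matrix of
`Δ` plus the identity, so that `(H ^ 2) x y` (`codeg`) is the number of common closed neighbours
of `x` and `y`.

*Spectral part.* Traces of polynomials in `H` depend only on the spectrum, so they can be computed
in the model graph. They show that `Δ` is regular (`IsCospectral.closedAdj_mul_onesMatrix`) and
that `H` satisfies the same cubic equation as the model, with an all-ones matrix `J` on the right
(`IsCospectral.closedAdj_cubic`). Hence `P = (H ^ 2 - q (n - 2) H - 2 q J) / (q (n - 1))`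
satisfies `P ^ 2 = q P` and `P J = q J`. As non-adjacent vertices have exactly `2 q` common
neighbours, `P x y` vanishes off the closed neighbourhood of `x`, it is `1` for `x = y`, and on
the closed neighbourhood it is `(codeg x y - q n) / (q (n - 1))`. In the model, `P` is the
relation of lying in a common fibre; the point is to recover this in `Δ`. The properties kept are
collected in `IsGridLike`.

*Lines.* By the congruence condition a non-zero entry of `P` is at least `q⁻²` in absolute value,
while each row of `P` has square sum `q`. Hence all but at most `(q - 1) q ^ 4` neighbours `y` of `x`
are *ordinary*: `codeg x y = q n`, about half the valency. Since non-adjacent vertices have few common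
neighbours, no three ordinary neighbours are pairwise non-adjacent, and this forces exactly two
maximal cliques of size close to `q n` (*lines*) through each vertex. A neighbour `y` of `x` on
neither line would have so few common neighbours with `x` that, first roughly and then by the
congruence exactly, `P x y = -1`. This is impossible: `P / q` is a projection, so `P x y = -1`
makes the rows of `x` and `y` opposite, although both sum to `q` (`IsGridLike.weight_ne_neg_one`).
Thus the closed neighbourhood of `x` is the union of two lines (`IsGridLike.closedNbhd_eq_union`).
On their intersection `P x ·` is `1`, and elsewhere the congruence forces it to be `0`. So
intersecting lines share exactly `q` vertices, and lines have exactly `q n` vertices.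

*Coordinates.* Counting edges between two disjoint lines shows that disjointness of lines is
transitive (`IsGridLike.disjoint_trans`), and there are no three pairwise intersecting lines
(`IsGridLike.not_three_lines`). So the lines form two parallel classes of `n` lines each, and the
two lines through a vertex are its coordinates in the grid.
-/

/-! ### Traces of polynomials in a symmetric matrix -/

open Polynomial Matrix Unitary in
/-- The spectral theorem for polynomials in a symmetric matrix. -/
theorem Matrix.IsHermitian.aeval_eq_conj {V : Type*} [Fintype V] [DecidableEq V]
    {A : Matrix V V ℝ} (hA : A.IsHermitian) (p : ℝ[X]) :
    aeval A p = conjStarAlgAut ℝ _ hA.eigenvectorUnitary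
      (diagonal fun i => p.eval (hA.eigenvalues i)) := by
  have h : diagonal (fun i => p.eval (hA.eigenvalues i)) =
      aeval (diagonal (RCLike.ofReal ∘ hA.eigenvalues) : Matrix V V ℝ) p := by
    have h1 := Polynomial.aeval_algHom_apply (Matrix.diagonalAlgHom (n := V) (α := ℝ) ℝ)
      hA.eigenvalues p
    have h2 : aeval hA.eigenvalues p = fun i => p.eval (hA.eigenvalues i) := by
      funext i
      rw [Polynomial.aeval_fn_apply, Polynomial.coe_aeval_eq_eval]
    rw [h2] at h1
    exact h1.symm
  conv_lhs => rw [hA.spectral_theorem]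
  rw [h]
  exact Polynomial.aeval_algHom_apply
    (conjStarAlgAut ℝ _ hA.eigenvectorUnitary).toAlgEquiv.toAlgHom _ p

open Polynomial Matrix Unitary in
theorem Matrix.IsHermitian.trace_aeval {V : Type*} [Fintype V] [DecidableEq V]
    {A : Matrix V V ℝ} (hA : A.IsHermitian) (p : ℝ[X]) :
    (aeval A p).trace = (A.charpoly.roots.map fun r => p.eval r).sum := by
  rw [hA.aeval_eq_conj, hA.roots_charpoly_eq_eigenvalues, conjStarAlgAut_apply,
    Matrix.trace_mul_cycle]
  simp [Matrix.trace_diagonal]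

open Polynomial Matrix Unitary in
/-- A polynomial that is nonnegative on the spectrum takes the matrix to a positive semidefinite
one. -/
theorem Matrix.IsHermitian.posSemidef_aeval {V : Type*} [Fintype V] [DecidableEq V]
    {A : Matrix V V ℝ} (hA : A.IsHermitian) (p : ℝ[X])
    (hp : ∀ r ∈ A.charpoly.roots, 0 ≤ p.eval r) : (aeval A p).PosSemidef := by
  rw [hA.aeval_eq_conj, conjStarAlgAut_apply]
  refine PosSemidef.mul_mul_conjTranspose_same (PosSemidef.diagonal fun i => hp _ ?_) _
  rw [hA.roots_charpoly_eq_eigenvalues]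
  simp

open Polynomial Matrix in
/-- A polynomial `p` with `tr (p(A) ^ 2) = 0` vanishes on the spectrum, since this trace is a sum of
squares. -/
theorem Matrix.IsHermitian.eval_root_eq_zero {V : Type*} [Fintype V] [DecidableEq V]
    {A : Matrix V V ℝ} (hA : A.IsHermitian) {p : ℝ[X]} (hp : (aeval A (p ^ 2)).trace = 0) {r : ℝ}
    (hr : r ∈ A.charpoly.roots) : p.eval r = 0 := by
  rw [hA.trace_aeval] at hp
  have h0 : ∀ x ∈ A.charpoly.roots.map fun r => (p ^ 2).eval r, x = 0 := by
    refine Multiset.all_zero_of_le_zero_le_of_sum_eq_zero ?_ hp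
    intro x hx
    obtain ⟨r, -, rfl⟩ := Multiset.mem_map.1 hx
    rw [eval_pow]; positivity
  simpa using h0 _ (Multiset.mem_map_of_mem _ hr)

open Polynomial Matrix in
open scoped Classical in
theorem IsCospectral.trace_aeval {V W : Type*} [Fintype V] [Fintype W] {G : SimpleGraph V}
    {H : SimpleGraph W} (h : IsCospectral G H) (p : ℝ[X]) :
    (aeval (G.adjMatrix ℝ) p).trace = (aeval (H.adjMatrix ℝ) p).trace := by
  have hG : (G.adjMatrix ℝ).IsHermitian := by
    simp [Matrix.IsHermitian, conjTranspose_eq_transpose_of_trivial]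
  have hH : (H.adjMatrix ℝ).IsHermitian := by
    simp [Matrix.IsHermitian, conjTranspose_eq_transpose_of_trivial]
  rw [hG.trace_aeval, hH.trace_aeval]
  exact congrArg (fun s : Multiset ℝ => (s.map fun r => p.eval r).sum) h

open Polynomial Matrix in
open scoped Classical in
theorem IsCospectral.trace_aeval_add_one {V W : Type*} [Fintype V] [Fintype W] {G : SimpleGraph V}
    {H : SimpleGraph W} (h : IsCospectral G H) (p : ℝ[X]) :
    (aeval (G.adjMatrix ℝ + 1) p).trace = (aeval (H.adjMatrix ℝ + 1) p).trace := by
  have := h.trace_aeval (p.comp (X + 1))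
  simpa [aeval_comp] using this

/-! ### The closed adjacency matrix of the model graph -/

/-- The square all-ones matrix. -/
def onesMatrix (V : Type*) : Matrix V V ℝ := Matrix.of fun _ _ => 1

open Matrix in
theorem onesMatrix_mul_self (V : Type*) [Fintype V] :
    onesMatrix V * onesMatrix V = (Fintype.card V : ℝ) • onesMatrix V := by
  ext i j
  simp [onesMatrix, Matrix.mul_apply]

open scoped Kronecker in
/-- The closed adjacency matrix (adjacency matrix plus identity) of the `q`-clique extension of the
`n × n` grid, as a Kronecker product. -/
noncomputable def closedGrid (q n : ℕ) :
    Matrix ((Fin n × Fin n) × Fin q) ((Fin n × Fin n) × Fin q) ℝ :=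
  ((1 : Matrix (Fin n) (Fin n) ℝ) ⊗ₖ onesMatrix (Fin n)
    + onesMatrix (Fin n) ⊗ₖ (1 : Matrix (Fin n) (Fin n) ℝ)
    - (1 : Matrix (Fin n) (Fin n) ℝ) ⊗ₖ (1 : Matrix (Fin n) (Fin n) ℝ)) ⊗ₖ onesMatrix (Fin q)

open scoped Classical in
theorem adjMatrix_cliqueExtension_gridGraph_add_one (q n : ℕ) :
    (cliqueExtension q (gridGraph n n)).adjMatrix ℝ + 1 = closedGrid q n := by
  ext ⟨⟨a, b⟩, i⟩ ⟨⟨c, d⟩, j⟩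
  simp only [closedGrid, Matrix.add_apply, SimpleGraph.adjMatrix_apply, cliqueExtension, gridGraph,
    SimpleGraph.boxProd_adj, Matrix.kroneckerMap_apply, Matrix.sub_apply, onesMatrix,
    Matrix.of_apply, Matrix.one_apply, SimpleGraph.top_adj, Prod.mk.injEq, ne_eq]
  by_cases h1 : a = c <;> by_cases h2 : b = d <;> by_cases h3 : i = j <;> simp [h1, h2, h3]

open scoped Kronecker in
/-- The matrix `T` is the relation of lying in the same fibre of the clique extension. Together with
the closed adjacency matrix and the all-ones matrix it spans a space closed under multiplication by
the closed adjacency matrix. -/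
theorem closedGrid_mul_identities (q n : ℕ) :
    ∃ T : Matrix ((Fin n × Fin n) × Fin q) ((Fin n × Fin n) × Fin q) ℝ, (∀ x, T x x = 1) ∧
    closedGrid q n * closedGrid q n = (q * (n - 2) : ℝ) • closedGrid q n + (q * (n - 1) : ℝ) • T
      + (2 * q : ℝ) • onesMatrix _ ∧
    closedGrid q n * T = (q : ℝ) • closedGrid q n ∧
    closedGrid q n * onesMatrix _ = (q * (2 * n - 1) : ℝ) • onesMatrix _ := by
  refine ⟨((1 : Matrix (Fin n) (Fin n) ℝ) ⊗ₖ (1 : Matrix (Fin n) (Fin n) ℝ)) ⊗ₖ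
    onesMatrix (Fin q), by simp [onesMatrix], ?_⟩
  have hJ : onesMatrix ((Fin n × Fin n) × Fin q) =
      (onesMatrix (Fin n) ⊗ₖ onesMatrix (Fin n)) ⊗ₖ onesMatrix (Fin q) := by
    ext; simp [onesMatrix]
  rw [closedGrid, hJ]
  simp only [← Matrix.mul_kronecker_mul, Matrix.add_mul, Matrix.mul_add, Matrix.sub_mul,
    Matrix.mul_sub, onesMatrix_mul_self, one_mul, mul_one, Fintype.card_fin]
  refine ⟨?_, ?_, ?_⟩ <;>
  · ext ⟨⟨a, b⟩, i⟩ ⟨⟨c, d⟩, j⟩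
    simp only [Matrix.kroneckerMap_apply, Matrix.add_apply, Matrix.sub_apply, Matrix.smul_apply,
      onesMatrix, Matrix.of_apply, smul_eq_mul]
    ring

open Matrix in
theorem closedGrid_identities (q n : ℕ) :
    closedGrid q n ^ 3 - (q * (n - 2) : ℝ) • closedGrid q n ^ 2
        - (q ^ 2 * (n - 1) : ℝ) • closedGrid q n
      = (2 * q ^ 2 * (2 * n - 1) : ℝ) • onesMatrix _ ∧
    (closedGrid q n ^ 2).trace = (n * n * q) * (q * (2 * n - 1)) ∧
    closedGrid q n * onesMatrix _ = (q * (2 * n - 1) : ℝ) • onesMatrix _ := by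
  obtain ⟨T, h0, h1, h2, h3⟩ := closedGrid_mul_identities q n
  refine ⟨?_, ?_, h3⟩
  · have : closedGrid q n ^ 3 = closedGrid q n * (closedGrid q n * closedGrid q n) := by
      noncomm_ring
    rw [this, h1, mul_add, mul_add, mul_smul_comm, mul_smul_comm, mul_smul_comm, h2, h3, sq, h1]
    simp only [smul_add, smul_smul]
    module
  · rw [sq, h1, trace_add, trace_add, trace_smul, trace_smul, trace_smul]
    simp [Matrix.trace, closedGrid, onesMatrix, h0, Fintype.card_prod]
    ring

/-! ### Consequences of cospectrality -/

open Polynomial in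
/-- The cubic that takes the closed adjacency matrix of the model graph to a multiple of the
all-ones matrix. Its roots are the eigenvalues of that matrix other than the valency plus one. -/
noncomputable def gridCubic (q n : ℕ) : ℝ[X] :=
  X ^ 3 - C (q * (n - 2) : ℝ) * X ^ 2 - C (q ^ 2 * (n - 1) : ℝ) * X

open Polynomial in
theorem aeval_gridCubic {V : Type*} [Fintype V] [DecidableEq V] (q n : ℕ) (H : Matrix V V ℝ) :
    aeval H (gridCubic q n) = H ^ 3 - (q * (n - 2) : ℝ) • H ^ 2 - (q ^ 2 * (n - 1) : ℝ) • H := by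
  simp only [gridCubic, map_sub, map_mul, map_pow, aeval_X, aeval_C, Algebra.smul_def]

open Polynomial in
theorem eval_gridCubic (q n : ℕ) (r : ℝ) :
    (gridCubic q n).eval r = r * (r - q * (n - 1)) * (r + q) := by
  simp only [gridCubic, eval_sub, eval_mul, eval_pow, eval_X, eval_C]
  ring

theorem onesMatrix_trace (V : Type*) [Fintype V] : (onesMatrix V).trace = Fintype.card V := by
  simp [Matrix.trace, onesMatrix]

open Polynomial Matrix in
open scoped Classical in
/-- Traces computed in the model graph. The last one says that the closed adjacency matrix is
annihilated by the cubic times the linear factor of the largest eigenvalue. -/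
theorem IsCospectral.trace_identities {V : Type*} [Fintype V] {Δ : SimpleGraph V} {q n : ℕ}
    (h : IsCospectral Δ (cliqueExtension q (gridGraph n n))) :
    (Fintype.card V : ℝ) = n * n * q ∧
    ((Δ.adjMatrix ℝ + 1) ^ 2).trace = ((n : ℝ) * n * q) * (q * (2 * n - 1)) ∧
    (aeval (Δ.adjMatrix ℝ + 1) (gridCubic q n ^ 2)).trace =
      ((2 * (q : ℝ) ^ 2 * (2 * n - 1)) * (n * n * q)) ^ 2 ∧
    (aeval (Δ.adjMatrix ℝ + 1)
      (((X - C (q * (2 * n - 1) : ℝ)) * gridCubic q n) ^ 2)).trace = 0 := by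
  have key : ∀ p : ℝ[X], (aeval (Δ.adjMatrix ℝ + 1) p).trace =
      (aeval (closedGrid q n) p).trace := by
    intro p
    rw [h.trace_aeval_add_one p, ← adjMatrix_cliqueExtension_gridGraph_add_one]
    congr!
  obtain ⟨h1, h2, h3⟩ := closedGrid_identities q n
  have hc : aeval (closedGrid q n) (gridCubic q n)
      = (2 * q ^ 2 * (2 * n - 1) : ℝ) • onesMatrix _ := by rw [aeval_gridCubic, h1]
  have hcard : (Fintype.card ((Fin n × Fin n) × Fin q) : ℝ) = n * n * q := by
    simp [Fintype.card_prod]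
  refine ⟨?_, ?_, ?_, ?_⟩
  · have := key 1
    simpa [Fintype.card_prod] using this
  · have := key (X ^ 2)
    rw [map_pow, map_pow, aeval_X, aeval_X] at this
    rw [this, h2]
  · rw [key, map_pow, hc, sq, smul_mul_smul_comm, onesMatrix_mul_self, smul_smul, trace_smul,
      onesMatrix_trace, hcard, smul_eq_mul]
    ring
  · have : aeval (closedGrid q n) ((X - C (q * (2 * n - 1) : ℝ)) * gridCubic q n) = 0 := by
      rw [map_mul, hc, map_sub, aeval_X, aeval_C, mul_smul_comm, sub_mul, h3,
        ← Algebra.smul_def, sub_self, smul_zero]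
    rw [key, map_pow, this]
    simp

open Polynomial Matrix in
open scoped Classical in
/-- A graph cospectral to the model is regular of the same valency. -/
theorem IsCospectral.closedAdj_mul_onesMatrix {V : Type*} [Fintype V] {Δ : SimpleGraph V} {q n : ℕ}
    (hn : 1 ≤ n)
    (h : IsCospectral Δ (cliqueExtension q (gridGraph n n))) :
    (Δ.adjMatrix ℝ + 1) * onesMatrix V = (q * (2 * n - 1) : ℝ) • onesMatrix V := by
  obtain ⟨h1, h2, -, h4⟩ := h.trace_identities
  set H := Δ.adjMatrix ℝ + 1 with hHdef
  have hH : H.IsHermitian := by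
    simp [hHdef, Matrix.IsHermitian, conjTranspose_eq_transpose_of_trivial]
  have hn' : (1 : ℝ) ≤ n := by exact_mod_cast hn
  have hq' : (0 : ℝ) ≤ q := by positivity
  -- Every eigenvalue is at most `q (2 n - 1)`, the sum of the entries of `H` is this bound times
  -- the number of vertices, and so the all-ones vector is an eigenvector.
  have hpsd : (aeval H (C (q * (2 * n - 1) : ℝ) - X)).PosSemidef := by
    refine hH.posSemidef_aeval _ fun r hr => ?_
    have := hH.eval_root_eq_zero h4 hr
    rw [eval_mul, eval_gridCubic, eval_sub, eval_X, eval_C, mul_eq_zero, mul_eq_zero,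
      mul_eq_zero] at this
    rw [eval_sub, eval_X, eval_C]
    rcases this with h | (h | h) | h <;> nlinarith
  have hM : aeval H (C (q * (2 * n - 1) : ℝ) - X) = (q * (2 * n - 1) : ℝ) • 1 - H := by
    rw [map_sub, aeval_X, aeval_C, Algebra.algebraMap_eq_smul_one]
  rw [hM] at hpsd
  -- `H` is a symmetric matrix with entries `0` and `1`.
  have hsum : ∑ x, ∑ y, H x y = (H ^ 2).trace := by
    rw [sq, Matrix.trace]
    refine Finset.sum_congr rfl fun x _ => ?_
    rw [diag_apply, mul_apply]
    refine Finset.sum_congr rfl fun y _ => ?_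
    have hs : H y x = H x y := by simpa using hH.apply x y
    rw [hs]
    simp only [hHdef, Matrix.add_apply, SimpleGraph.adjMatrix_apply, one_apply]
    by_cases hxy : x = y
    · subst hxy; simp
    · by_cases ha : Δ.Adj x y <;> simp [hxy, ha]
  have h0 : star (1 : V → ℝ) ⬝ᵥ (((q * (2 * n - 1) : ℝ) • 1 - H) *ᵥ 1) = 0 := by
    rw [sub_mulVec, dotProduct_sub, smul_mulVec, one_mulVec]
    have : star (1 : V → ℝ) ⬝ᵥ (H *ᵥ 1) = ∑ x, ∑ y, H x y := by
      simp [dotProduct, mulVec]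
    rw [this, hsum, h2]
    simp [h1]; ring
  have h5 := (hpsd.dotProduct_mulVec_zero_iff _).1 h0
  ext x y
  have := congrFun h5 x
  rw [sub_mulVec, smul_mulVec, one_mulVec, Pi.sub_apply, Pi.zero_apply] at this
  simp only [mul_apply, onesMatrix, of_apply, mul_one, Matrix.smul_apply]
  simp [mulVec, dotProduct] at this
  simp; linarith

open Polynomial Matrix in
open scoped Classical in
/-- The cubic identity of the model holds in `Δ`: the difference of the two sides is a symmetric
matrix whose square has trace zero. -/
theorem IsCospectral.closedAdj_cubic {V : Type*} [Fintype V] {Δ : SimpleGraph V} {q n : ℕ}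
    (hn : 1 ≤ n)
    (h : IsCospectral Δ (cliqueExtension q (gridGraph n n))) :
    (Δ.adjMatrix ℝ + 1) ^ 3 - (q * (n - 2) : ℝ) • (Δ.adjMatrix ℝ + 1) ^ 2
      - (q ^ 2 * (n - 1) : ℝ) • (Δ.adjMatrix ℝ + 1)
      = (2 * q ^ 2 * (2 * n - 1) : ℝ) • onesMatrix V := by
  obtain ⟨h1, h2, h3, -⟩ := h.trace_identities
  have hreg := h.closedAdj_mul_onesMatrix hn
  set H := Δ.adjMatrix ℝ + 1 with hHdef
  have hH : Hᵀ = H := by simp [hHdef]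
  rw [← aeval_gridCubic] 
  set c : ℝ := 2 * q ^ 2 * (2 * n - 1) with hc
  set Q := aeval H (gridCubic q n) with hQ
  have hQJ : Q * onesMatrix V = (c * (n * n * q)) • onesMatrix V := by
    have e2 : H ^ 2 * onesMatrix V = (q * (2 * n - 1) : ℝ) ^ 2 • onesMatrix V := by
      rw [sq, mul_assoc, hreg, mul_smul_comm, hreg, smul_smul, sq]
    have e3 : H ^ 3 * onesMatrix V = (q * (2 * n - 1) : ℝ) ^ 3 • onesMatrix V := by
      rw [pow_succ', mul_assoc, e2, mul_smul_comm, hreg, smul_smul]; ring_nf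
    rw [hQ, aeval_gridCubic, sub_mul, sub_mul, smul_mul_assoc, smul_mul_assoc, hreg, e2, e3,
      smul_smul, smul_smul, ← sub_smul, ← sub_smul]
    congr 1
    rw [hc]; ring
  have hQt : Qᵀ = Q := by
    rw [hQ, aeval_gridCubic]
    simp [transpose_pow, hH]
  have hJt : (onesMatrix V)ᵀ = onesMatrix V := by ext; simp [onesMatrix]
  have : (Q - c • onesMatrix V)ᴴ * (Q - c • onesMatrix V) = 
      Q * Q - c • (onesMatrix V * Q) - c • (Q * onesMatrix V) 
      + (c * c * Fintype.card V) • onesMatrix V := by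
    rw [conjTranspose_eq_transpose_of_trivial, transpose_sub, transpose_smul, hQt, hJt, sub_mul,
      mul_sub, mul_sub, smul_mul_smul_comm, onesMatrix_mul_self, smul_smul, mul_smul_comm,
      smul_mul_assoc]
    abel
  refine sub_eq_zero.1 (trace_conjTranspose_mul_self_eq_zero_iff.1 ?_)
  rw [this, trace_add, trace_sub, trace_sub, trace_smul, trace_smul, trace_mul_comm (onesMatrix V),
    hQJ, trace_smul, trace_smul, onesMatrix_trace, h1, ← sq, hQ, ← map_pow, h3]
  simp only [smul_eq_mul]
  ring

/-! ### Closed neighbourhoods and weights -/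

open scoped Classical in
/-- The closed neighbourhood of a vertex. -/
noncomputable def closedNbhd {V : Type*} [Fintype V] (Δ : SimpleGraph V) (x : V) : Finset V :=
  {y | y = x ∨ Δ.Adj x y}

theorem mem_closedNbhd {V : Type*} [Fintype V] {Δ : SimpleGraph V} {x y : V} :
    y ∈ closedNbhd Δ x ↔ y = x ∨ Δ.Adj x y := by
  simp [closedNbhd]

theorem self_mem_closedNbhd {V : Type*} [Fintype V] {Δ : SimpleGraph V} (x : V) :
    x ∈ closedNbhd Δ x := mem_closedNbhd.2 (Or.inl rfl)

theorem mem_closedNbhd_comm {V : Type*} [Fintype V] {Δ : SimpleGraph V} {x y : V} :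
    y ∈ closedNbhd Δ x ↔ x ∈ closedNbhd Δ y := by
  rw [mem_closedNbhd, mem_closedNbhd, Δ.adj_comm, eq_comm]

open scoped Classical in
/-- The number of common closed neighbours. -/
noncomputable def codeg {V : Type*} [Fintype V] (Δ : SimpleGraph V) (x y : V) : ℕ :=
  (closedNbhd Δ x ∩ closedNbhd Δ y).card

open scoped Classical in
/-- The entry of the matrix `P = (H ^ 2 - q (n - 2) H - 2 q J) / (q (n - 1))`, where `H` is the
closed adjacency matrix and `J` the all-ones matrix, written out for a graph in which vertices
`x`, `y` with `y` outside the closed neighbourhood of `x` have `2 q` common neighbours. -/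
noncomputable def weight {V : Type*} [Fintype V] (Δ : SimpleGraph V) (q n : ℕ) (x y : V) : ℝ :=
  if y ∈ closedNbhd Δ x then (codeg Δ x y - q * n : ℝ) / (q * (n - 1)) else 0

open scoped Classical in
theorem codeg_comm {V : Type*} [Fintype V] (Δ : SimpleGraph V) (x y : V) :
    codeg Δ x y = codeg Δ y x := by
  rw [codeg, codeg, Finset.inter_comm]

theorem weight_comm {V : Type*} [Fintype V] (Δ : SimpleGraph V) (q n : ℕ) (x y : V) :
    weight Δ q n x y = weight Δ q n y x := by
  have h := mem_closedNbhd_comm (Δ := Δ) (x := x) (y := y)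
  by_cases hy : y ∈ closedNbhd Δ x
  · simp [weight, codeg_comm Δ x y, hy, h.1 hy]
  · simp [weight, hy, mt h.2 hy]

/-- The combinatorial properties of a graph cospectral to the `q`-clique extension of the `n × n`
grid that are used to reconstruct the grid. The last two say that the matrix `P` of weights
satisfies `P J = q J` and `P ^ 2 = q P`. -/
structure IsGridLike {V : Type*} [Fintype V] (Δ : SimpleGraph V) (q M n : ℕ) : Prop where
  two_le : 2 ≤ q
  n_eq : n = q * M + 1
  le_n : 8 * q ^ 4 ≤ n
  card_closedNbhd : ∀ x, (closedNbhd Δ x).card + q = 2 * (q * n)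
  codeg_eq : ∀ x y, y ∉ closedNbhd Δ x → codeg Δ x y = 2 * q
  codeg_modEq : ∀ x y, y ∈ closedNbhd Δ x → codeg Δ x y ≡ q [MOD M]
  sum_weight : ∀ x, ∑ y, weight Δ q n x y = q
  sum_weight_mul : ∀ x y, ∑ z, weight Δ q n x z * weight Δ q n y z = q * weight Δ q n x y

open scoped Classical in
theorem codeg_eq_ncard_of_not_adj {V : Type*} [Fintype V] {Δ : SimpleGraph V} {x y : V}
    (h : y ∉ closedNbhd Δ x) : codeg Δ x y = (Δ.commonNeighbors x y).ncard := by
  rw [codeg, ← Set.ncard_coe_finset]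
  congr 1
  ext z
  have h' := mt mem_closedNbhd_comm.2 h
  simp only [Finset.coe_inter, Set.mem_inter_iff, Finset.mem_coe, SimpleGraph.mem_commonNeighbors]
  constructor
  · rintro ⟨h1, h2⟩
    refine ⟨(mem_closedNbhd.1 h1).resolve_left ?_, (mem_closedNbhd.1 h2).resolve_left ?_⟩
    · rintro rfl; exact h' h2
    · rintro rfl; exact h h1
  · rintro ⟨h1, h2⟩
    exact ⟨mem_closedNbhd.2 (Or.inr h1), mem_closedNbhd.2 (Or.inr h2)⟩

open scoped Classical in
theorem codeg_eq_ncard_of_adj {V : Type*} [Fintype V] {Δ : SimpleGraph V} {x y : V}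
    (h : Δ.Adj x y) : codeg Δ x y = (Δ.commonNeighbors x y).ncard + 2 := by
  have : ((closedNbhd Δ x ∩ closedNbhd Δ y : Finset V) : Set V) =
      insert x (insert y (Δ.commonNeighbors x y)) := by
    ext z
    simp only [Finset.coe_inter, Set.mem_inter_iff, Finset.mem_coe, mem_closedNbhd,
      Set.mem_insert_iff, SimpleGraph.mem_commonNeighbors]
    constructor
    · tauto
    · rintro (rfl | rfl | h2)
      · exact ⟨Or.inl rfl, Or.inr h.symm⟩
      · exact ⟨Or.inr h, Or.inl rfl⟩
      · exact ⟨Or.inr h2.1, Or.inr h2.2⟩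
  rw [codeg, ← Set.ncard_coe_finset, this, Set.ncard_insert_of_notMem, Set.ncard_insert_of_notMem]
  · simp [SimpleGraph.mem_commonNeighbors]
  · simp [SimpleGraph.mem_commonNeighbors, h.ne]

open scoped Classical in
theorem closedAdj_apply {V : Type*} [Fintype V] (Δ : SimpleGraph V) (x y : V) :
    (Δ.adjMatrix ℝ + 1) x y = if y ∈ closedNbhd Δ x then 1 else 0 := by
  rw [Matrix.add_apply, SimpleGraph.adjMatrix_apply, Matrix.one_apply]
  by_cases hxy : x = y
  · subst hxy; simp [self_mem_closedNbhd]
  · have : y ≠ x := fun h => hxy h.symm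
    simp [mem_closedNbhd, hxy, this]

open scoped Classical in
theorem closedAdj_sq_apply {V : Type*} [Fintype V] (Δ : SimpleGraph V) (x y : V) :
    ((Δ.adjMatrix ℝ + 1) ^ 2 : Matrix V V ℝ) x y = codeg Δ x y := by
  rw [sq, Matrix.mul_apply]
  simp_rw [closedAdj_apply, mem_closedNbhd_comm (x := _) (y := y)]
  rw [codeg, Finset.card_eq_sum_ones]
  simp_rw [ite_mul, one_mul, zero_mul, ← ite_and]
  rw [← Finset.sum_filter]
  push_cast
  refine Finset.sum_congr ?_ fun _ _ => rfl
  ext z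
  simp

open scoped Classical in
theorem IsCospectral.isGridLike {V : Type*} [Fintype V] {Δ : SimpleGraph V} {q M n : ℕ}
    (hq : 2 ≤ q) (hn : n = q * M + 1) (hbig : 8 * q ^ 4 ≤ n)
    (h_adj : ∀ y z : V, Δ.Adj y z →
      ((Δ.commonNeighbors y z).ncard : ℤ) ≡ (q : ℤ) - 2 [ZMOD (M : ℤ)])
    (h_nonadj : ∀ y z : V, y ≠ z → ¬ Δ.Adj y z → (Δ.commonNeighbors y z).ncard = 2 * q)
    (h : IsCospectral Δ (cliqueExtension q (gridGraph n n))) : IsGridLike Δ q M n := by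
  have hq4 : 2 ^ 4 ≤ q ^ 4 := Nat.pow_le_pow_left hq 4
  have hn1 : 1 < n := by omega
  have hreg := h.closedAdj_mul_onesMatrix hn1.le
  have hcub := h.closedAdj_cubic hn1.le
  have hcard := h.trace_identities.1
  have hqR : (q : ℝ) ≠ 0 := by norm_cast; omega
  have hnR : (n : ℝ) - 1 ≠ 0 := by
    have : (1 : ℝ) < n := by exact_mod_cast hn1
    linarith
  have hdeg : ∀ x, ((closedNbhd Δ x).card : ℝ) = q * (2 * n - 1) := by
    intro x
    have := congrFun (congrFun hreg x) x
    rw [Matrix.mul_apply] at this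
    simp_rw [closedAdj_apply] at this
    simpa [onesMatrix] using this
  have hnon : ∀ x y, y ∉ closedNbhd Δ x → codeg Δ x y = 2 * q := by
    intro x y hxy
    rw [codeg_eq_ncard_of_not_adj hxy]
    rw [mem_closedNbhd, not_or] at hxy
    exact h_nonadj x y (Ne.symm hxy.1) hxy.2
  set H := Δ.adjMatrix ℝ + 1 with hH
  have hHs : H.transpose = H := by simp [hH]
  set P : Matrix V V ℝ := (q * (n - 1) : ℝ)⁻¹ •
    (H ^ 2 - (q * (n - 2) : ℝ) • H - (2 * q : ℝ) • onesMatrix V) with hP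
  have hPw : ∀ x y, P x y = weight Δ q n x y := by
    intro x y
    rw [hP, weight]
    simp only [Matrix.smul_apply, Matrix.sub_apply, hH, closedAdj_sq_apply, closedAdj_apply,
      onesMatrix, Matrix.of_apply, smul_eq_mul]
    split_ifs with hxy
    · field_simp; ring
    · rw [hnon x y hxy]; push_cast; ring
  have hJJ := onesMatrix_mul_self V
  have hJH : onesMatrix V * H = (q * (2 * n - 1) : ℝ) • onesMatrix V := by
    have hJt : (onesMatrix V).transpose = onesMatrix V := by ext; simp [onesMatrix]
    have := congrArg Matrix.transpose hreg
    rwa [Matrix.transpose_mul, hHs, Matrix.transpose_smul, hJt] at this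
  have hH2 : H ^ 2 =
      (q * (n - 1) : ℝ) • P + (q * (n - 2) : ℝ) • H + (2 * q : ℝ) • onesMatrix V := by
    rw [hP, smul_inv_smul₀ (mul_ne_zero hqR hnR)]
    abel
  have hPJ : P * onesMatrix V = (q : ℝ) • onesMatrix V := by
    rw [hP, smul_mul_assoc, sub_mul, sub_mul, smul_mul_assoc, smul_mul_assoc, sq, mul_assoc, hreg,
      hJJ, mul_smul_comm, hreg, smul_smul, smul_smul, smul_smul, ← sub_smul, ← sub_smul, smul_smul,
      hcard]
    congr 1
    field_simp
    ring
  have hPH : P * H = (q : ℝ) • H := by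
    rw [hP, smul_mul_assoc, sub_mul, sub_mul, smul_mul_assoc, smul_mul_assoc, hJH, ← pow_succ, ← sq,
      sub_eq_iff_eq_add.1 (sub_eq_iff_eq_add.1 hcub), inv_smul_eq_iff₀ (mul_ne_zero hqR hnR)]
    module
  have hPP : P * P = (q : ℝ) • P := by
    conv_lhs => rhs; rw [hP]
    rw [mul_smul_comm, Matrix.mul_sub, Matrix.mul_sub, mul_smul_comm, mul_smul_comm, sq,
      ← mul_assoc, hPH,
      smul_mul_assoc, hPJ, ← sq, hH2, inv_smul_eq_iff₀ (mul_ne_zero hqR hnR)]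
    module
  have hPs : ∀ x y, P x y = P y x := by
    intro x y
    rw [hPw, hPw, weight_comm]
  refine ⟨hq, hn, hbig, ?_, hnon, ?_, ?_, ?_⟩
  · intro x
    have := hdeg x
    have : ((closedNbhd Δ x).card : ℝ) + q = 2 * (q * n) := by rw [this]; ring
    exact_mod_cast this
  · intro x y hxy
    rw [← Int.natCast_modEq_iff]
    rcases eq_or_ne y x with rfl | hne
    · have h1 := hdeg y
      have h2 : codeg Δ y y + q = 2 * (q * n) := by
        have : ((closedNbhd Δ y).card : ℝ) + q = 2 * (q * n) := by rw [h1]; ring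
        rw [codeg, Finset.inter_self]
        exact_mod_cast this
      have h3 : (codeg Δ y y : ℤ) = q + M * (2 * q * q) := by
        have : (codeg Δ y y : ℤ) + q = 2 * (q * n) := by exact_mod_cast h2
        rw [hn] at this
        push_cast at this
        linarith
      rw [h3]
      exact (Int.modEq_iff_dvd.2 ⟨-(2 * q * q), by ring⟩)
    · have ha := (mem_closedNbhd.1 hxy).resolve_left hne
      rw [codeg_eq_ncard_of_adj ha]
      have := (h_adj x y ha).add_right 2
      push_cast
      simpa using this
  · intro x
    have := congrFun (congrFun hPJ x) x
    rw [Matrix.mul_apply] at this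
    simpa [onesMatrix, hPw] using this
  · intro x y
    have := congrFun (congrFun hPP x) y
    rw [Matrix.mul_apply] at this
    simp only [Matrix.smul_apply, smul_eq_mul] at this
    rw [← hPw, ← this]
    refine Finset.sum_congr rfl fun z _ => ?_
    rw [hPs z y, hPw, hPw]

section Lines

/-! ### Ordinary neighbours -/

open scoped Classical

variable {V : Type*} [Fintype V] {Δ : SimpleGraph V} {q M n : ℕ}

namespace IsGridLike

theorem le_q_mul_n (h : IsGridLike Δ q M n) :
    64 * q ≤ n ∧ 128 * q ≤ q * n ∧ 8 * q < M := by
  have h1 := h.two_le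
  have h2 := h.le_n
  have h3 := h.n_eq
  have h4 : 2 ^ 3 ≤ q ^ 3 := Nat.pow_le_pow_left h1 3
  have h5 : q ^ 4 = q ^ 3 * q := pow_succ q 3
  have h6 : 8 * q ≤ q ^ 4 := by rw [h5]; exact Nat.mul_le_mul_right q h4
  refine ⟨by omega, ?_, ?_⟩
  · have : 128 ≤ n := by omega
    nlinarith
  · have : q * (8 * q ^ 3) ≤ q * M + 1 := by rw [← h3]; linarith [h5]
    by_contra hM
    have h7 : q * M ≤ q * (8 * q) := Nat.mul_le_mul_left q (by omega)
    have h8 : q ^ 3 = q * q * q := by ring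
    nlinarith [mul_pos (show 0 < q by omega) (show 0 < q by omega)]

theorem codeg_self (h : IsGridLike Δ q M n) (x : V) : codeg Δ x x + q = 2 * (q * n) := by
  rw [codeg, Finset.inter_self, h.card_closedNbhd]

theorem weight_of_mem (h : IsGridLike Δ q M n) {x y : V} (hy : y ∈ closedNbhd Δ x) :
    weight Δ q n x y * (q * (n - 1)) = codeg Δ x y - q * n := by
  have h1 := h.two_le
  obtain ⟨h2, -, -⟩ := h.le_q_mul_n
  have hqR : (q : ℝ) ≠ 0 := by norm_cast; omega
  have hnR : (n : ℝ) - 1 ≠ 0 := by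
    have : (1 : ℝ) < n := by norm_cast; omega
    linarith
  rw [weight, if_pos hy]
  field_simp

theorem q_mul_n_sub_one_pos (h : IsGridLike Δ q M n) : (0 : ℝ) < q * (n - 1) := by
  have h1 := h.two_le
  obtain ⟨h2, -, -⟩ := h.le_q_mul_n
  have : (1 : ℝ) < n := by norm_cast; omega
  have : (0 : ℝ) < q := by norm_cast; omega
  exact mul_pos this (by linarith)

theorem weight_eq_one_of_codeg (h : IsGridLike Δ q M n) {x y : V} (hy : y ∈ closedNbhd Δ x)
    (hc : codeg Δ x y + q = 2 * (q * n)) : weight Δ q n x y = 1 := by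
  have h1 := h.weight_of_mem hy
  have h2 : (codeg Δ x y : ℝ) + q = 2 * (q * n) := by exact_mod_cast hc
  refine mul_right_cancel₀ h.q_mul_n_sub_one_pos.ne' ?_
  rw [h1]
  linarith

theorem weight_self (h : IsGridLike Δ q M n) (x : V) : weight Δ q n x x = 1 :=
  h.weight_eq_one_of_codeg (self_mem_closedNbhd x) (h.codeg_self x)

theorem weight_eq_zero_of_codeg (h : IsGridLike Δ q M n) {x y : V} (hy : y ∈ closedNbhd Δ x)
    (hc : codeg Δ x y = q * n) : weight Δ q n x y = 0 := by
  have h1 := h.weight_of_mem hy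
  rw [hc] at h1
  refine mul_right_cancel₀ h.q_mul_n_sub_one_pos.ne' ?_
  rw [h1]
  push_cast
  ring

theorem sum_sq_weight (h : IsGridLike Δ q M n) (x : V) : ∑ y, weight Δ q n x y ^ 2 = q := by
  have := h.sum_weight_mul x x
  rw [h.weight_self, mul_one] at this
  simpa [sq] using this

/-- A set of vertices on which the squared weights are bounded below is small. -/
theorem card_mul_le_of_sq_weight (h : IsGridLike Δ q M n) {x : V} {S : Finset V} (hx : x ∉ S)
    {b : ℝ} (hS : ∀ y ∈ S, b ≤ weight Δ q n x y ^ 2) : S.card * b ≤ q - 1 := by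
  have h1 : ∑ y ∈ insert x S, weight Δ q n x y ^ 2 ≤ q := by
    rw [← h.sum_sq_weight x]
    exact Finset.sum_le_univ_sum_of_nonneg fun _ => sq_nonneg _
  rw [Finset.sum_insert hx, h.weight_self] at h1
  have h2 := Finset.card_nsmul_le_sum S _ b hS
  rw [nsmul_eq_mul] at h2
  linarith

/-- Codegrees on a closed neighbourhood are congruent to `q * n` modulo `M`, so one at distance less
than `M` from `q * n` equals it. -/
theorem eq_of_codeg_lt (h : IsGridLike Δ q M n) {x y : V} (hy : y ∈ closedNbhd Δ x)
    (h1 : codeg Δ x y < q * n + M) (h2 : q * n < codeg Δ x y + M) : codeg Δ x y = q * n := by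
  have hn : q * n ≡ codeg Δ x y [MOD M] := by
    refine Nat.ModEq.trans ?_ (h.codeg_modEq x y hy).symm
    have e : q * n = q + M * (q * q) := by rw [h.n_eq]; ring
    simp [e, Nat.ModEq]
  rcases le_total (q * n) (codeg Δ x y) with hle | hle
  · have := Nat.eq_zero_of_dvd_of_lt ((Nat.modEq_iff_dvd' hle).1 hn) (by omega)
    omega
  · have := Nat.eq_zero_of_dvd_of_lt ((Nat.modEq_iff_dvd' hle).1 hn.symm) (by omega)
    omega

/-- Vertices with the wrong codegree have squared weight at least `q⁻⁴`, so there are at most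
`(q - 1) q ^ 4` of them in a closed neighbourhood; the bound `8 q ^ 4 ≤ n` makes this at most
`(q - 1) n / 8`. -/
theorem card_exceptional (h : IsGridLike Δ q M n) (x : V) :
    8 * ((closedNbhd Δ x).filter fun y => y ≠ x ∧ codeg Δ x y ≠ q * n).card + n ≤ q * n := by
  set S := (closedNbhd Δ x).filter fun y => y ≠ x ∧ codeg Δ x y ≠ q * n with hS
  have h1 := h.two_le
  have hq0 : (0 : ℝ) < q := by norm_cast; omega
  have key : S.card * (1 / (q : ℝ) ^ 4) ≤ q - 1 := by
    refine h.card_mul_le_of_sq_weight (x := x) (by simp [hS]) fun y hy => ?_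
    rw [hS, Finset.mem_filter] at hy
    have hw := h.weight_of_mem hy.1
    -- The codegree differs from `q * n` by at least `M`, and `n - 1 = q * M`.
    have hM : (M : ℝ) ^ 2 ≤ ((codeg Δ x y : ℝ) - q * n) ^ 2 := by
      rw [sq_le_sq, abs_of_nonneg (Nat.cast_nonneg M), le_abs]
      by_contra! hcon
      refine hy.2.2 (h.eq_of_codeg_lt hy.1 ?_ ?_)
      · have : (codeg Δ x y : ℝ) < q * n + M := by linarith [hcon.1]
        exact_mod_cast this
      · have : (q : ℝ) * n < codeg Δ x y + M := by linarith [hcon.2]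
        exact_mod_cast this
    have hnM : (n : ℝ) - 1 = q * M := by rw [h.n_eq]; push_cast; ring
    rw [← hw, hnM] at hM
    have hM0 : (0 : ℝ) < M := by
      have := h.le_q_mul_n.2.2
      norm_cast; omega
    rw [div_le_iff₀ (by positivity)]
    have : (M : ℝ) ^ 2 * 1 ≤ (M : ℝ) ^ 2 * (weight Δ q n x y ^ 2 * q ^ 4) := by
      nlinarith
    exact le_of_mul_le_mul_left this (by positivity)
  have h2 : (S.card : ℝ) ≤ (q - 1) * q ^ 4 := by
    rw [mul_one_div, div_le_iff₀ (by positivity)] at key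
    exact key
  have h3 : (8 : ℝ) * q ^ 4 ≤ n := by exact_mod_cast h.le_n
  have h4 : (1 : ℝ) ≤ q := by norm_cast; omega
  have : (8 : ℝ) * S.card + n ≤ q * n := by nlinarith
  exact_mod_cast this

end IsGridLike

theorem Finset.card_add_card_add_card_le {α : Type*} [DecidableEq α] {A B C S : Finset α}
    (hA : A ⊆ S) (hB : B ⊆ S) (hC : C ⊆ S) :
    A.card + B.card + C.card ≤ S.card + (A ∩ B).card + (A ∩ C).card + (B ∩ C).card := by
  have h1 := Finset.card_union_add_card_inter A B
  have h2 := Finset.card_union_add_card_inter (A ∪ B) C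
  have h3 : ((A ∪ B) ∩ C).card ≤ (A ∩ C).card + (B ∩ C).card := by
    rw [Finset.union_inter_distrib_right]
    exact Finset.card_union_le _ _
  have h4 := Finset.card_le_card (Finset.union_subset (Finset.union_subset hA hB) hC)
  omega

/-- The ordinary neighbours of `x`: those adjacent to `x` with the codegree of two distinct vertices
in a common row or column of the grid. -/
noncomputable def ordinaryNbrs (Δ : SimpleGraph V) (q n : ℕ) (x : V) : Finset V :=
  (closedNbhd Δ x).filter fun y => y ≠ x ∧ codeg Δ x y = q * n

theorem IsGridLike.card_ordinaryNbrs (h : IsGridLike Δ q M n) (x : V) :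
    15 * (q * n) + n ≤ 8 * (ordinaryNbrs Δ q n x).card + 8 * q + 8 := by
  have h1 := h.card_exceptional x
  have h2 := h.card_closedNbhd x
  have h3 : (closedNbhd Δ x).card ≤ 1 + (ordinaryNbrs Δ q n x).card +
      ((closedNbhd Δ x).filter fun y => y ≠ x ∧ codeg Δ x y ≠ q * n).card := by
    rw [← Finset.card_singleton x]
    refine (Finset.card_le_card ?_).trans ((Finset.card_union_le _ _).trans
      (Nat.add_le_add_right (Finset.card_union_le _ _) _))
    intro y hy
    simp only [ordinaryNbrs, Finset.mem_union, Finset.mem_singleton, Finset.mem_filter]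
    tauto
  omega

/-- Three pairwise non-adjacent ordinary neighbours of a vertex do not exist, because their
neighbourhoods would be too large to fit into that of the vertex. -/
theorem IsGridLike.exists_mem_of_ordinaryNbrs (h : IsGridLike Δ q M n) {x a b c : V}
    (ha : a ∈ ordinaryNbrs Δ q n x) (hb : b ∈ ordinaryNbrs Δ q n x)
    (hc : c ∈ ordinaryNbrs Δ q n x) (hab : b ∉ closedNbhd Δ a) (hac : c ∉ closedNbhd Δ a) :
    c ∈ closedNbhd Δ b := by
  by_contra hbc
  rw [ordinaryNbrs, Finset.mem_filter] at ha hb hc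
  have h1 := h.card_closedNbhd x
  have h2 := h.le_q_mul_n
  have h3 := Finset.card_add_card_add_card_le (S := closedNbhd Δ x)
    (A := closedNbhd Δ x ∩ closedNbhd Δ a) (B := closedNbhd Δ x ∩ closedNbhd Δ b)
    (C := closedNbhd Δ x ∩ closedNbhd Δ c) Finset.inter_subset_left Finset.inter_subset_left
    Finset.inter_subset_left
  have key : ∀ u v : V, v ∉ closedNbhd Δ u →
      ((closedNbhd Δ x ∩ closedNbhd Δ u) ∩ (closedNbhd Δ x ∩ closedNbhd Δ v)).card ≤ 2 * q := by
    intro u v huv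
    rw [← h.codeg_eq u v huv]
    exact Finset.card_le_card (Finset.inter_subset_inter Finset.inter_subset_right
      Finset.inter_subset_right)
  have h4 := key a b hab
  have h5 := key a c hac
  have h6 := key b c hbc
  have e1 := ha.2.2
  have e2 := hb.2.2
  have e3 := hc.2.2
  rw [codeg] at e1 e2 e3
  have := h.two_le
  omega

/-! ### Lines -/

/-- A *line* is a maximal clique with at least `7/8` of the size of a row of the clique extension
of the grid. -/
def IsLine (Δ : SimpleGraph V) (q n : ℕ) (C : Finset V) : Prop :=
  Maximal (fun C : Finset V => Δ.IsClique (C : Set V)) C ∧ 7 * (q * n) ≤ 8 * C.card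

theorem isClique_iff_closedNbhd {C : Finset V} :
    Δ.IsClique (C : Set V) ↔ ∀ x ∈ C, ∀ y ∈ C, y ∈ closedNbhd Δ x := by
  simp only [SimpleGraph.isClique_iff, Set.Pairwise, Finset.mem_coe, mem_closedNbhd]
  constructor
  · intro h x hx y hy
    by_cases hxy : y = x
    · exact Or.inl hxy
    · exact Or.inr (h hx hy (Ne.symm hxy))
  · intro h x hx y hy hxy
    exact (h x hx y hy).resolve_left (Ne.symm hxy)

theorem IsLine.mem_closedNbhd {C : Finset V} (hC : IsLine Δ q n C) {x y : V} (hx : x ∈ C)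
    (hy : y ∈ C) : y ∈ closedNbhd Δ x :=
  isClique_iff_closedNbhd.1 hC.1.prop x hx y hy

theorem IsLine.exists_notMem_closedNbhd {C : Finset V} (hC : IsLine Δ q n C) {y : V} (hy : y ∉ C) :
    ∃ c ∈ C, y ∉ closedNbhd Δ c := by
  by_contra! hcon
  refine hy (hC.1.le_of_ge (y := insert y C) ?_ (Finset.subset_insert y C)
    (Finset.mem_insert_self y C))
  refine isClique_iff_closedNbhd.2 fun a ha b hb => ?_
  rw [Finset.mem_insert] at ha hb
  rcases ha with rfl | ha
  · rcases hb with rfl | hb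
    · exact self_mem_closedNbhd _
    · exact mem_closedNbhd_comm.1 (hcon b hb)
  · rcases hb with rfl | hb
    · exact hcon a ha
    · exact hC.mem_closedNbhd ha hb

/-- A vertex `y` outside a line is non-adjacent to some `c` on it, and every neighbour of `y` on the
line is a common neighbour of `y` and `c`. -/
theorem IsLine.card_inter_closedNbhd_le (h : IsGridLike Δ q M n) {C : Finset V}
    (hC : IsLine Δ q n C) {y : V} (hy : y ∉ C) : (C ∩ closedNbhd Δ y).card ≤ 2 * q := by
  obtain ⟨c, hc, hyc⟩ := hC.exists_notMem_closedNbhd hy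
  rw [← h.codeg_eq c y hyc]
  refine Finset.card_le_card (Finset.inter_subset_inter (fun z hz => ?_) subset_rfl)
  exact hC.mem_closedNbhd hc hz

theorem IsLine.exists_mem_notMem {V : Type*} {Δ : SimpleGraph V} {C C' : Finset V}
    {q n : ℕ} (hC : IsLine Δ q n C) (hC' : IsLine Δ q n C') (hne : C ≠ C') : ∃ y ∈ C', y ∉ C := by
  by_contra! hcon
  exact hne (subset_antisymm (hC'.1.le_of_ge hC.1.prop hcon) hcon)

theorem IsLine.card_inter_le (h : IsGridLike Δ q M n) {C C' : Finset V}
    (hC : IsLine Δ q n C) (hC' : IsLine Δ q n C') (hne : C ≠ C') : (C ∩ C').card ≤ 2 * q := by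
  obtain ⟨y, hy', hy⟩ := hC.exists_mem_notMem hC' hne
  refine (Finset.card_le_card ?_).trans (hC.card_inter_closedNbhd_le h hy)
  exact Finset.inter_subset_inter subset_rfl fun z hz => hC'.mem_closedNbhd hy' hz

/-- For ordinary neighbours `y`, `z` of `x` that are not adjacent, the ordinary neighbours of `x`
not adjacent to `z` form, together with `x`, a large clique through `y`. -/
theorem IsGridLike.exists_isLine_of_ordinaryNbrs (h : IsGridLike Δ q M n) {x y z : V}
    (hy : y ∈ ordinaryNbrs Δ q n x) (hz : z ∈ ordinaryNbrs Δ q n x) (hyz : y ∉ closedNbhd Δ z) :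
    ∃ C, IsLine Δ q n C ∧ x ∈ C ∧ y ∈ C := by
  set Y := ordinaryNbrs Δ q n x \ closedNbhd Δ z with hY
  have hYx : ∀ a ∈ Y, a ∈ closedNbhd Δ x ∧ a ≠ x := by
    intro a ha
    rw [hY, Finset.mem_sdiff, ordinaryNbrs, Finset.mem_filter] at ha
    exact ⟨ha.1.1, ha.1.2.1⟩
  have hcl : Δ.IsClique ((insert x Y : Finset V) : Set V) := by
    refine isClique_iff_closedNbhd.2 fun a ha b hb => ?_
    rw [Finset.mem_insert] at ha hb
    rcases ha with rfl | ha
    · rcases hb with rfl | hb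
      · exact self_mem_closedNbhd _
      · exact (hYx b hb).1
    · rcases hb with rfl | hb
      · exact mem_closedNbhd_comm.1 (hYx a ha).1
      · rw [hY, Finset.mem_sdiff] at ha hb
        exact h.exists_mem_of_ordinaryNbrs hz ha.1 hb.1 ha.2 hb.2
  obtain ⟨C, hCle, hC⟩ := Set.Finite.exists_le_maximal
    (s := {C : Finset V | Δ.IsClique (C : Set V)}) (Set.toFinite _) hcl
  have hcard : (ordinaryNbrs Δ q n x).card ≤ Y.card + q * n := by
    have h1 := Finset.card_sdiff_add_card_inter (ordinaryNbrs Δ q n x) (closedNbhd Δ z)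
    have h2 : (ordinaryNbrs Δ q n x ∩ closedNbhd Δ z).card ≤ codeg Δ x z :=
      Finset.card_le_card (Finset.inter_subset_inter (Finset.filter_subset _ _) subset_rfl)
    rw [ordinaryNbrs, Finset.mem_filter] at hz
    rw [hz.2.2] at h2
    rw [← hY] at h1
    omega
  refine ⟨C, ⟨hC, ?_⟩, hCle (Finset.mem_insert_self _ _), hCle (Finset.mem_insert_of_mem ?_)⟩
  · have h1 := Finset.card_le_card hCle
    rw [Finset.card_insert_of_notMem fun hx => (hYx x hx).2 rfl] at h1
    have h2 := h.card_ordinaryNbrs x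
    have h3 := h.le_q_mul_n
    omega
  · exact Finset.mem_sdiff.2 ⟨hy, hyz⟩

theorem IsGridLike.exists_two_lines (h : IsGridLike Δ q M n) (x : V) :
    ∃ C₁ C₂, IsLine Δ q n C₁ ∧ IsLine Δ q n C₂ ∧ C₁ ≠ C₂ ∧ x ∈ C₁ ∧ x ∈ C₂ := by
  have h2 := h.card_ordinaryNbrs x
  have h3 := h.le_q_mul_n
  obtain ⟨y, hy⟩ : (ordinaryNbrs Δ q n x).Nonempty := by
    rw [← Finset.card_pos]; have := h.two_le; omega
  obtain ⟨z, hz, hyz⟩ : ∃ z ∈ ordinaryNbrs Δ q n x, z ∉ closedNbhd Δ y := by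
    by_contra! hcon
    have h4 : (ordinaryNbrs Δ q n x).card ≤ codeg Δ x y :=
      Finset.card_le_card (Finset.subset_inter (Finset.filter_subset _ _) hcon)
    rw [ordinaryNbrs, Finset.mem_filter] at hy
    rw [hy.2.2] at h4
    have := h.two_le
    omega
  obtain ⟨C₁, hC₁, hx₁, hy₁⟩ := h.exists_isLine_of_ordinaryNbrs hy hz (mt mem_closedNbhd_comm.2 hyz)
  obtain ⟨C₂, hC₂, hx₂, hz₂⟩ := h.exists_isLine_of_ordinaryNbrs hz hy hyz
  refine ⟨C₁, C₂, hC₁, hC₂, ?_, hx₁, hx₂⟩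
  rintro rfl
  exact hyz (hC₁.mem_closedNbhd hy₁ hz₂)

/-- Three lines through a vertex would be too large for its closed neighbourhood. -/
theorem IsGridLike.eq_or_eq_of_isLine (h : IsGridLike Δ q M n) {x : V} {C₁ C₂ C : Finset V}
    (h₁ : IsLine Δ q n C₁) (h₂ : IsLine Δ q n C₂) (hne : C₁ ≠ C₂) (hx₁ : x ∈ C₁) (hx₂ : x ∈ C₂)
    (hC : IsLine Δ q n C) (hx : x ∈ C) : C = C₁ ∨ C = C₂ := by
  by_contra! hcon
  have h3 := Finset.card_add_card_add_card_le (S := closedNbhd Δ x)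
    (fun _ => h₁.mem_closedNbhd hx₁) (fun _ => h₂.mem_closedNbhd hx₂)
    (fun _ => hC.mem_closedNbhd hx)
  have h4 := h₁.card_inter_le h h₂ hne
  have h5 := h₁.card_inter_le h hC hcon.1.symm
  have h6 := h₂.card_inter_le h hC hcon.2.symm
  have h7 := h.card_closedNbhd x
  have h8 := h.le_q_mul_n
  have := h.two_le
  have := h₁.2
  have := h₂.2
  have := hC.2
  omega

/-! ### The closed neighbourhood as a union of two lines -/

/-- By `P ^ 2 = q P` and `P x x = P y y = 1`, the rows of `x` and `y` would be opposite if
`P x y = -1`, but both sum to `q`. -/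
theorem IsGridLike.weight_ne_neg_one (h : IsGridLike Δ q M n) (x y : V) :
    weight Δ q n x y ≠ -1 := by
  intro hw
  have h1 : ∑ z, (weight Δ q n x z + weight Δ q n y z) ^ 2 = 0 := by
    have : ∀ z, (weight Δ q n x z + weight Δ q n y z) ^ 2 = weight Δ q n x z ^ 2 +
        2 * (weight Δ q n x z * weight Δ q n y z) + weight Δ q n y z ^ 2 := fun z => by ring
    simp_rw [this]
    rw [Finset.sum_add_distrib, Finset.sum_add_distrib, ← Finset.mul_sum, h.sum_sq_weight,
      h.sum_sq_weight, h.sum_weight_mul, hw]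
    ring
  rw [Finset.sum_eq_zero_iff_of_nonneg fun _ _ => sq_nonneg _] at h1
  have h2 : ∑ z, (weight Δ q n x z + weight Δ q n y z) = 0 :=
    Finset.sum_eq_zero fun z hz => pow_eq_zero_iff two_ne_zero |>.1 (h1 z hz)
  rw [Finset.sum_add_distrib, h.sum_weight, h.sum_weight] at h2
  have : (0 : ℝ) < q := by have := h.two_le; norm_cast; omega
  linarith

/-- The two lines through a vertex cover its closed neighbourhood. -/
theorem IsGridLike.closedNbhd_eq_union (h : IsGridLike Δ q M n) {x : V} {C₁ C₂ : Finset V}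
    (h₁ : IsLine Δ q n C₁) (h₂ : IsLine Δ q n C₂) (hne : C₁ ≠ C₂) (hx₁ : x ∈ C₁) (hx₂ : x ∈ C₂) :
    closedNbhd Δ x = C₁ ∪ C₂ := by
  have hsub : C₁ ∪ C₂ ⊆ closedNbhd Δ x :=
    Finset.union_subset (fun _ => h₁.mem_closedNbhd hx₁) (fun _ => h₂.mem_closedNbhd hx₂)
  refine subset_antisymm (fun y hy => ?_) hsub
  by_contra hy12
  have hq := h.two_le
  have hnum := h.le_q_mul_n
  set R := closedNbhd Δ x \ (C₁ ∪ C₂) with hR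
  have hcod : ∀ z ∈ R, codeg Δ x z ≤ 4 * q + R.card := by
    intro z hz
    rw [hR, Finset.mem_sdiff, Finset.mem_union, not_or] at hz
    have e1 := h₁.card_inter_closedNbhd_le h hz.2.1
    have e2 := h₂.card_inter_closedNbhd_le h hz.2.2
    have e3 : codeg Δ x z ≤ ((C₁ ∩ closedNbhd Δ z) ∪ (C₂ ∩ closedNbhd Δ z) ∪ R).card := by
      refine Finset.card_le_card fun w hw => ?_
      simp only [hR, Finset.mem_inter, Finset.mem_union, Finset.mem_sdiff] at hw ⊢
      tauto
    have e4 := Finset.card_union_le ((C₁ ∩ closedNbhd Δ z) ∪ (C₂ ∩ closedNbhd Δ z)) R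
    have e5 := Finset.card_union_le (C₁ ∩ closedNbhd Δ z) (C₂ ∩ closedNbhd Δ z)
    omega
  have hRcard : 8 * R.card ≤ 2 * (q * n) + 8 * q := by
    have e1 := Finset.card_sdiff_add_card_eq_card hsub
    rw [← hR] at e1
    have e2 := Finset.card_union_add_card_inter C₁ C₂
    have e3 := h₁.card_inter_le h h₂ hne
    have e4 := h.card_closedNbhd x
    have := h₁.2
    have := h₂.2
    omega
  have hpos := h.q_mul_n_sub_one_pos
  -- Vertices of `R` have weight at most `-3/5`, and the squared weights of the row sum to `q`.
  have hR3 : R.card ≤ 3 * q := by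
    have key : R.card * (1 / 3 : ℝ) ≤ q - 1 := by
      refine h.card_mul_le_of_sq_weight (x := x) (fun hx => ?_) fun z hz => ?_
      · rw [hR, Finset.mem_sdiff, Finset.mem_union] at hx
        exact hx.2 (Or.inl hx₁)
      · have e1 := h.weight_of_mem (Finset.mem_sdiff.1 (hR ▸ hz)).1
        have e2 := hcod z hz
        have e3 : 4 * codeg Δ x z ≤ q * n + 20 * q := by omega
        have e3' : (4 : ℝ) * codeg Δ x z ≤ q * n + 20 * q := by exact_mod_cast e3
        have e4 : (128 : ℝ) * q ≤ q * n := by exact_mod_cast hnum.2.1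
        have e5 : (2 : ℝ) ≤ q := by exact_mod_cast hq
        have e6 : weight Δ q n x z ≤ -(3 / 5) := by
          refine le_of_mul_le_mul_right ?_ hpos
          rw [e1]
          nlinarith
        nlinarith
    have : (R.card : ℝ) ≤ 3 * q := by linarith
    exact_mod_cast this
  have hyR : y ∈ R := Finset.mem_sdiff.2 ⟨hy, hy12⟩
  -- Now the codegree is at most `7 q < M`, and it is congruent to `q` modulo `M`.
  have hyq : codeg Δ x y = q := by
    have e1 := hcod y hyR
    exact (h.codeg_modEq x y hy).eq_of_lt_of_lt (by omega) (by omega)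
  refine h.weight_ne_neg_one x y (mul_right_cancel₀ hpos.ne' ?_)
  rw [h.weight_of_mem hy, hyq]
  ring

theorem IsGridLike.le_codeg_of_mem_line (h : IsGridLike Δ q M n) {x y : V} {C₁ C₂ : Finset V}
    (h₁ : IsLine Δ q n C₁) (h₂ : IsLine Δ q n C₂) (hne : C₁ ≠ C₂) (hx₁ : x ∈ C₁) (hx₂ : x ∈ C₂)
    (hy₁ : y ∈ C₁) (hy₂ : y ∉ C₂) :
    C₁.card ≤ codeg Δ x y ∧ codeg Δ x y ≤ C₁.card + 2 * q := by
  constructor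
  · exact Finset.card_le_card (Finset.subset_inter (fun _ => h₁.mem_closedNbhd hx₁)
      (fun _ => h₁.mem_closedNbhd hy₁))
  · have e1 : codeg Δ x y ≤ (C₁ ∪ (C₂ ∩ closedNbhd Δ y)).card := by
      rw [codeg, h.closedNbhd_eq_union h₁ h₂ hne hx₁ hx₂]
      refine Finset.card_le_card fun w hw => ?_
      simp only [Finset.mem_inter, Finset.mem_union] at hw ⊢
      tauto
    have e2 := Finset.card_union_le C₁ (C₂ ∩ closedNbhd Δ y)
    have e3 := h₂.card_inter_closedNbhd_le h hy₂
    omega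

/-- Some vertex of `C₁` outside `C₂` is an ordinary neighbour of `x`; its codegree is `q * n`. -/
theorem IsGridLike.card_line_le (h : IsGridLike Δ q M n) {x : V} {C₁ C₂ : Finset V}
    (h₁ : IsLine Δ q n C₁) (h₂ : IsLine Δ q n C₂) (hne : C₁ ≠ C₂) (hx₁ : x ∈ C₁) (hx₂ : x ∈ C₂) :
    C₁.card ≤ q * n ∧ q * n ≤ C₁.card + 2 * q := by
  obtain ⟨y, hy₁, hy₂, hy⟩ : ∃ y ∈ C₁, y ∉ C₂ ∧ codeg Δ x y = q * n := by
    by_contra! hcon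
    have e1 : (C₁ \ C₂).card ≤
        ((closedNbhd Δ x).filter fun y => y ≠ x ∧ codeg Δ x y ≠ q * n).card := by
      refine Finset.card_le_card fun y hy => ?_
      rw [Finset.mem_sdiff] at hy
      refine Finset.mem_filter.2 ⟨h₁.mem_closedNbhd hx₁ hy.1, ?_, hcon y hy.1 hy.2⟩
      rintro rfl
      exact hy.2 hx₂
    have e2 := h.card_exceptional x
    have e3 := Finset.card_sdiff_add_card_inter C₁ C₂
    have e4 := h₁.card_inter_le h h₂ hne
    have e5 := h.le_q_mul_n
    have e6 := h₁.2
    have := h.two_le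
    omega
  rw [← hy]
  exact h.le_codeg_of_mem_line h₁ h₂ hne hx₁ hx₂ hy₁ hy₂

theorem IsGridLike.weight_eq_zero_of_mem_line (h : IsGridLike Δ q M n) {x y : V} {C₁ C₂ : Finset V}
    (h₁ : IsLine Δ q n C₁) (h₂ : IsLine Δ q n C₂) (hne : C₁ ≠ C₂) (hx₁ : x ∈ C₁) (hx₂ : x ∈ C₂)
    (hy₁ : y ∈ C₁) (hy₂ : y ∉ C₂) : weight Δ q n x y = 0 := by
  have hy := h₁.mem_closedNbhd hx₁ hy₁
  have e1 := h.card_line_le h₁ h₂ hne hx₁ hx₂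
  have e2 := h.le_codeg_of_mem_line h₁ h₂ hne hx₁ hx₂ hy₁ hy₂
  have e3 := h.le_q_mul_n
  have := h.two_le
  exact h.weight_eq_zero_of_codeg hy (h.eq_of_codeg_lt hy (by omega) (by omega))

theorem IsGridLike.weight_eq_one_of_mem_inter (h : IsGridLike Δ q M n) {x y : V} {C₁ C₂ : Finset V}
    (h₁ : IsLine Δ q n C₁) (h₂ : IsLine Δ q n C₂) (hne : C₁ ≠ C₂) (hx₁ : x ∈ C₁) (hx₂ : x ∈ C₂)
    (hy₁ : y ∈ C₁) (hy₂ : y ∈ C₂) : weight Δ q n x y = 1 := by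
  refine h.weight_eq_one_of_codeg (h₁.mem_closedNbhd hx₁ hy₁) ?_
  rw [codeg, h.closedNbhd_eq_union h₁ h₂ hne hy₁ hy₂,
    ← h.closedNbhd_eq_union h₁ h₂ hne hx₁ hx₂, Finset.inter_self, h.card_closedNbhd]

/-- The row of `x` is the indicator function of the intersection of the two lines through `x`, and
it sums to `q`. -/
theorem IsGridLike.card_inter_eq (h : IsGridLike Δ q M n) {x : V} {C₁ C₂ : Finset V}
    (h₁ : IsLine Δ q n C₁) (h₂ : IsLine Δ q n C₂) (hne : C₁ ≠ C₂) (hx₁ : x ∈ C₁) (hx₂ : x ∈ C₂) :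
    (C₁ ∩ C₂).card = q := by
  have e1 : ∑ y, weight Δ q n x y = ∑ y ∈ C₁ ∩ C₂, (1 : ℝ) := by
    rw [← Finset.sum_subset (Finset.subset_univ (C₁ ∩ C₂))]
    · refine Finset.sum_congr rfl fun y hy => ?_
      rw [Finset.mem_inter] at hy
      exact h.weight_eq_one_of_mem_inter h₁ h₂ hne hx₁ hx₂ hy.1 hy.2
    · intro y _ hy
      by_cases hy₁ : y ∈ C₁
      · exact h.weight_eq_zero_of_mem_line h₁ h₂ hne hx₁ hx₂ hy₁
          fun hy₂ => hy (Finset.mem_inter.2 ⟨hy₁, hy₂⟩)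
      by_cases hy₂ : y ∈ C₂
      · exact h.weight_eq_zero_of_mem_line h₂ h₁ hne.symm hx₂ hx₁ hy₂ hy₁
      · rw [weight, if_neg]
        rw [h.closedNbhd_eq_union h₁ h₂ hne hx₁ hx₂, Finset.mem_union]
        tauto
  rw [h.sum_weight, Finset.sum_const, nsmul_eq_mul, mul_one] at e1
  exact_mod_cast e1.symm

theorem IsGridLike.exists_other_line (h : IsGridLike Δ q M n) {x : V} {C : Finset V}
    (hC : IsLine Δ q n C) (hx : x ∈ C) : ∃ C', IsLine Δ q n C' ∧ C ≠ C' ∧ x ∈ C' := by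
  obtain ⟨C₁, C₂, h₁, h₂, hne, hx₁, hx₂⟩ := h.exists_two_lines x
  rcases h.eq_or_eq_of_isLine h₁ h₂ hne hx₁ hx₂ hC hx with rfl | rfl
  · exact ⟨C₂, h₂, hne, hx₂⟩
  · exact ⟨C₁, h₁, hne.symm, hx₁⟩

theorem IsGridLike.card_line (h : IsGridLike Δ q M n) {C : Finset V} (hC : IsLine Δ q n C) :
    C.card = q * n := by
  have hnum := h.le_q_mul_n
  have hq := h.two_le
  obtain ⟨x, hx⟩ : C.Nonempty := by
    rw [← Finset.card_pos]; have := hC.2; omega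
  obtain ⟨C', hC', hne, hx'⟩ := h.exists_other_line hC hx
  have e1 := Finset.card_union_add_card_inter C C'
  rw [← h.closedNbhd_eq_union hC hC' hne hx hx', h.card_inter_eq hC hC' hne hx hx',
    h.card_closedNbhd] at e1
  have e2 := h.card_line_le hC hC' hne hx hx'
  have e3 := h.card_line_le hC' hC hne.symm hx' hx
  omega

theorem IsGridLike.card_inter_le (h : IsGridLike Δ q M n) {C₁ C₂ : Finset V}
    (h₁ : IsLine Δ q n C₁) (h₂ : IsLine Δ q n C₂) (hne : C₁ ≠ C₂) : (C₁ ∩ C₂).card ≤ q := by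
  rcases (C₁ ∩ C₂).eq_empty_or_nonempty with he | ⟨x, hx⟩
  · simp [he]
  · rw [Finset.mem_inter] at hx
    exact (h.card_inter_eq h₁ h₂ hne hx.1 hx.2).le

/-! ### Parallel classes of lines -/

/-- Disjointness of lines is transitive. If `L₁` and `L₃` met in `x`, the `2 q` common neighbours
of `x` and a vertex of `L₂` would include `q` vertices of `L₁`. A vertex of `L₁` has at most `q`
neighbours on `L₂`, and `x` has none, so counting edges between `L₁` and `L₂` gives a
contradiction. -/
theorem IsGridLike.disjoint_trans (h : IsGridLike Δ q M n) {L₁ L₂ L₃ : Finset V}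
    (h₁ : IsLine Δ q n L₁) (h₂ : IsLine Δ q n L₂) (h₃ : IsLine Δ q n L₃) (h₁₂ : Disjoint L₁ L₂)
    (h₂₃ : Disjoint L₂ L₃) (hne : L₁ ≠ L₃) : Disjoint L₁ L₃ := by
  by_contra hcon
  obtain ⟨x, hx₁, hx₃⟩ := Finset.not_disjoint_iff.1 hcon
  have hbx := h.closedNbhd_eq_union h₁ h₃ hne hx₁ hx₃
  have hlow : ∀ y ∈ L₂, q ≤ (L₁.bipartiteAbove (fun y z => z ∈ closedNbhd Δ y) y).card := by
    intro y hy
    have hy₁ : y ∉ L₁ := Finset.disjoint_right.1 h₁₂ hy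
    have hy₃ : y ∉ L₃ := Finset.disjoint_left.1 h₂₃ hy
    obtain ⟨L', h', hne', hy'⟩ := h.exists_other_line h₂ hy
    have hby := h.closedNbhd_eq_union h₂ h' hne' hy hy'
    have e1 : codeg Δ x y = 2 * q := by
      refine h.codeg_eq x y ?_
      rw [hbx, Finset.mem_union]
      tauto
    have e2 : codeg Δ x y ≤ ((L₁ ∩ L') ∪ (L₃ ∩ L')).card := by
      rw [codeg, hbx, hby]
      refine Finset.card_le_card fun w hw => ?_
      have d1 : w ∈ L₁ → w ∉ L₂ := fun hw => Finset.disjoint_left.1 h₁₂ hw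
      have d2 : w ∈ L₂ → w ∉ L₃ := fun hw => Finset.disjoint_left.1 h₂₃ hw
      simp only [Finset.mem_inter, Finset.mem_union] at hw ⊢
      tauto
    have e3 := Finset.card_union_le (L₁ ∩ L') (L₃ ∩ L')
    have e4 := h.card_inter_le h₃ h' (by rintro rfl; exact hy₃ hy')
    have e5 : (L₁ ∩ L').card ≤
        (L₁.bipartiteAbove (fun y z => z ∈ closedNbhd Δ y) y).card := by
      refine Finset.card_le_card fun w hw => ?_
      rw [Finset.mem_inter] at hw
      exact Finset.mem_filter.2 ⟨hw.1, h'.mem_closedNbhd hy' hw.2⟩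
    omega
  have hup : ∀ z ∈ L₁, (L₂.bipartiteBelow (fun y z => z ∈ closedNbhd Δ y) z).card ≤ q := by
    intro z hz
    have hz₂ : z ∉ L₂ := Finset.disjoint_left.1 h₁₂ hz
    obtain ⟨L', h', hne', hz'⟩ := h.exists_other_line h₁ hz
    refine (Finset.card_le_card fun y hy => ?_).trans
      (h.card_inter_le h₂ h' (by rintro rfl; exact hz₂ hz'))
    have hy := Finset.mem_filter.1 hy
    have d1 := Finset.disjoint_right.1 h₁₂ hy.1
    have hyz := mem_closedNbhd_comm.1 hy.2
    rw [h.closedNbhd_eq_union h₁ h' hne' hz hz', Finset.mem_union] at hyz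
    exact Finset.mem_inter.2 ⟨hy.1, hyz.resolve_left d1⟩
  have hxx : (L₂.bipartiteBelow (fun y z => z ∈ closedNbhd Δ y) x).card < q := by
    have : L₂.bipartiteBelow (fun y z => z ∈ closedNbhd Δ y) x = ∅ := by
      refine Finset.filter_eq_empty_iff.2 fun y hy hyx => ?_
      have hyx := mem_closedNbhd_comm.1 hyx
      rw [hbx, Finset.mem_union] at hyx
      exact hyx.elim (Finset.disjoint_right.1 h₁₂ hy) (Finset.disjoint_left.1 h₂₃ hy)
    rw [this, Finset.card_empty]
    have := h.two_le
    omega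
  have e1 := Finset.sum_card_bipartiteAbove_eq_sum_card_bipartiteBelow
    (s := L₂) (t := L₁) (fun y z => z ∈ closedNbhd Δ y)
  have e2 := Finset.card_nsmul_le_sum L₂ _ q hlow
  have e3 := Finset.sum_lt_sum hup ⟨x, hx₁, hxx⟩
  rw [Finset.sum_const, h.card_line h₁] at e3
  rw [h.card_line h₂, e1] at e2
  omega

/-- There are no three pairwise intersecting lines. Given `A`, `B`, `C` and `x ∈ A ∩ B`, a vertex
`z ∈ C` off `A` and `B` already has its `2 q` common neighbours with `x` on `C`, so the other line
through `z` is disjoint from `A` and `B`. -/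
theorem IsGridLike.not_three_lines (h : IsGridLike Δ q M n) {A B C : Finset V}
    (hA : IsLine Δ q n A) (hB : IsLine Δ q n B) (hC : IsLine Δ q n C) (hAB : ¬ Disjoint A B)
    (hAC : ¬ Disjoint A C) (hBC : ¬ Disjoint B C) (nAB : A ≠ B) (nAC : A ≠ C) (nBC : B ≠ C) :
    False := by
  obtain ⟨x, hxA, hxB⟩ := Finset.not_disjoint_iff.1 hAB
  obtain ⟨a, haA, haC⟩ := Finset.not_disjoint_iff.1 hAC
  obtain ⟨b, hbB, hbC⟩ := Finset.not_disjoint_iff.1 hBC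
  have cA := h.card_inter_eq hA hC nAC haA haC
  have cB := h.card_inter_eq hB hC nBC hbB hbC
  have hnum := h.le_q_mul_n
  have hq := h.two_le
  have hbx := h.closedNbhd_eq_union hA hB nAB hxA hxB
  obtain ⟨z, hzC, hz⟩ : ∃ z ∈ C, z ∉ A ∪ B := by
    by_contra! hcon
    have e1 := Finset.card_le_card (show C ⊆ (A ∩ C) ∪ (B ∩ C) by
      rw [← Finset.union_inter_distrib_right]
      exact Finset.subset_inter hcon subset_rfl)
    have e2 := Finset.card_union_le (A ∩ C) (B ∩ C)
    have e3 := h.card_line hC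
    omega
  obtain ⟨C', hC', nCC', hzC'⟩ := h.exists_other_line hC hzC
  have hbz := h.closedNbhd_eq_union hC hC' nCC' hzC hzC'
  have e1 := h.codeg_eq x z (by rwa [hbx])
  rw [codeg, hbx, hbz] at e1
  have e2 : ((A ∪ B) ∩ C).card = 2 * q := by
    rw [Finset.union_inter_distrib_right, Finset.card_union_of_disjoint, cA, cB, two_mul]
    rw [Finset.disjoint_left]
    intro p hpA hpB
    rw [Finset.mem_inter] at hpA hpB
    rcases h.eq_or_eq_of_isLine hA hB nAB hpA.1 hpB.1 hC hpA.2 with e | e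
    · exact nAC e.symm
    · exact nBC e.symm
  have e3 : (A ∪ B) ∩ C = (A ∪ B) ∩ (C ∪ C') :=
    Finset.eq_of_subset_of_card_le
      (Finset.inter_subset_inter subset_rfl Finset.subset_union_left) (by omega)
  have key : ∀ A', IsLine Δ q n A' → A' ⊆ A ∪ B → A' ≠ C → Disjoint A' C' := by
    intro A' hA' hsub nA'
    rw [Finset.disjoint_left]
    intro p hp hp'
    have hpC : p ∈ (A ∪ B) ∩ C := by
      rw [e3]
      exact Finset.mem_inter.2 ⟨hsub hp, Finset.mem_union_right _ hp'⟩
    rcases h.eq_or_eq_of_isLine hC hC' nCC' (Finset.mem_inter.1 hpC).2 hp' hA' hp with e | e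
    · exact nA' e
    · subst e; exact hz (hsub hzC')
  exact hAB (h.disjoint_trans hA hC' hB (key A hA Finset.subset_union_left nAC)
    (key B hB Finset.subset_union_right nBC).symm nAB)

/-- The parallel class of `A`: the lines that are equal to `A` or disjoint from `A`. -/
noncomputable def parallelClass (Δ : SimpleGraph V) (q n : ℕ) (A : Finset V) :
    Finset (Finset V) :=
  Finset.univ.filter fun C => IsLine Δ q n C ∧ (C = A ∨ Disjoint C A)

theorem mem_parallelClass {A C : Finset V} :
    C ∈ parallelClass Δ q n A ↔ IsLine Δ q n C ∧ (C = A ∨ Disjoint C A) := by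
  simp [parallelClass]

theorem IsGridLike.eq_or_disjoint_of_mem_parallelClass (h : IsGridLike Δ q M n)
    {A C C' : Finset V} (hA : IsLine Δ q n A) (hC : C ∈ parallelClass Δ q n A)
    (hC' : C' ∈ parallelClass Δ q n A) : C = C' ∨ Disjoint C C' := by
  rw [mem_parallelClass] at hC hC'
  obtain ⟨h₁, rfl | h₂⟩ := hC
  · exact hC'.2.imp Eq.symm fun hd => hd.symm
  · obtain ⟨h₃, rfl | h₄⟩ := hC'
    · exact Or.inr h₂
    · by_cases he : C = C'
      · exact Or.inl he
      · exact Or.inr (h.disjoint_trans h₁ hA h₃ h₂ h₄.symm he)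

theorem IsGridLike.not_mem_parallelClass_both (h : IsGridLike Δ q M n) {A B C : Finset V}
    (hA : IsLine Δ q n A) (hB : IsLine Δ q n B) (hAB : ¬ Disjoint A B) (nAB : A ≠ B)
    (hCA : C ∈ parallelClass Δ q n A) : C ∉ parallelClass Δ q n B := by
  intro hCB
  have hC := (mem_parallelClass.1 hCA).1
  have h₁ : A ∈ parallelClass Δ q n C :=
    mem_parallelClass.2 ⟨hA, (mem_parallelClass.1 hCA).2.imp Eq.symm fun hd => hd.symm⟩
  have h₂ : B ∈ parallelClass Δ q n C :=
    mem_parallelClass.2 ⟨hB, (mem_parallelClass.1 hCB).2.imp Eq.symm fun hd => hd.symm⟩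
  exact (h.eq_or_disjoint_of_mem_parallelClass hC h₁ h₂).elim nAB hAB

theorem IsGridLike.mem_parallelClass_or (h : IsGridLike Δ q M n) {A B C : Finset V}
    (hA : IsLine Δ q n A) (hB : IsLine Δ q n B) (hAB : ¬ Disjoint A B) (nAB : A ≠ B)
    (hC : IsLine Δ q n C) : C ∈ parallelClass Δ q n A ∨ C ∈ parallelClass Δ q n B := by
  simp only [mem_parallelClass, hC, true_and]
  by_contra! hcon
  exact h.not_three_lines hA hB hC hAB (fun hd => hcon.1.2 hd.symm) (fun hd => hcon.2.2 hd.symm) nAB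
    hcon.1.1.symm hcon.2.1.symm

theorem IsGridLike.card_inter_eq_of_mem_parallelClass (h : IsGridLike Δ q M n)
    {A B C C' : Finset V} (hA : IsLine Δ q n A) (hB : IsLine Δ q n B) (hAB : ¬ Disjoint A B)
    (nAB : A ≠ B) (hC : C ∈ parallelClass Δ q n A) (hC' : C' ∈ parallelClass Δ q n B) :
    (C ∩ C').card = q := by
  have hl := (mem_parallelClass.1 hC).1
  have hl' := (mem_parallelClass.1 hC').1
  have h₁ : ¬ (C = C' ∨ Disjoint C C') := by
    intro hcon
    have h₂ : C ∈ parallelClass Δ q n C' := mem_parallelClass.2 ⟨hl, hcon⟩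
    have h₃ : B ∈ parallelClass Δ q n C' :=
      mem_parallelClass.2 ⟨hB, (mem_parallelClass.1 hC').2.imp Eq.symm fun hd => hd.symm⟩
    exact h.not_mem_parallelClass_both hA hB hAB nAB hC
      (mem_parallelClass.2 ⟨hl, h.eq_or_disjoint_of_mem_parallelClass hl' h₂ h₃⟩)
  rw [not_or] at h₁
  obtain ⟨x, hx, hx'⟩ := Finset.not_disjoint_iff.1 h₁.2
  exact h.card_inter_eq hl hl' h₁.1 hx hx'

theorem IsGridLike.exists_mem_parallelClass (h : IsGridLike Δ q M n) {A B : Finset V}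
    (hA : IsLine Δ q n A) (hB : IsLine Δ q n B) (hAB : ¬ Disjoint A B) (nAB : A ≠ B) (x : V) :
    ∃ C ∈ parallelClass Δ q n A, x ∈ C := by
  obtain ⟨C₁, C₂, h₁, h₂, hne, hx₁, hx₂⟩ := h.exists_two_lines x
  rcases h.mem_parallelClass_or hA hB hAB nAB h₁ with e₁ | e₁
  · exact ⟨C₁, e₁, hx₁⟩
  rcases h.mem_parallelClass_or hA hB hAB nAB h₂ with e₂ | e₂
  · exact ⟨C₂, e₂, hx₂⟩
  · exact ((h.eq_or_disjoint_of_mem_parallelClass hB e₁ e₂).elim hne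
      (Finset.not_disjoint_iff.2 ⟨x, hx₁, hx₂⟩)).elim

/-! ### Coordinates -/

/-- Every vertex lies on exactly one line `f x` of the parallel class of `A`, and there are `n` of
these lines because each of them meets the line `B` of the other class in `q` of its `q * n`
vertices. -/
theorem IsGridLike.exists_coordinate (h : IsGridLike Δ q M n) {A B : Finset V}
    (hA : IsLine Δ q n A) (hB : IsLine Δ q n B) (hAB : ¬ Disjoint A B) (nAB : A ≠ B) :
    (parallelClass Δ q n A).card = n ∧ ∃ f : V → parallelClass Δ q n A,
      ∀ x, ∀ C : parallelClass Δ q n A, x ∈ C.1 ↔ f x = C := by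
  choose f hf hxf using h.exists_mem_parallelClass hA hB hAB nAB
  have key : ∀ x, ∀ C ∈ parallelClass Δ q n A, x ∈ C ↔ f x = C := by
    intro x C hC
    constructor
    · intro hx
      exact (h.eq_or_disjoint_of_mem_parallelClass hA (hf x) hC).resolve_right
        (Finset.not_disjoint_iff.2 ⟨x, hxf x, hx⟩)
    · rintro rfl
      exact hxf x
  constructor
  · have e1 := Finset.card_eq_sum_card_fiberwise (s := B) (f := f) fun x _ => hf x
    rw [Finset.sum_congr rfl (g := fun _ => q), Finset.sum_const, h.card_line hB, smul_eq_mul,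
      mul_comm] at e1
    · exact (Nat.eq_of_mul_eq_mul_right (by have := h.two_le; omega) e1).symm
    · intro C hC
      rw [← h.card_inter_eq_of_mem_parallelClass hA hB hAB nAB hC
        (mem_parallelClass.2 ⟨hB, Or.inl rfl⟩)]
      congr 1
      ext x
      rw [Finset.mem_filter, Finset.mem_inter, key x C hC, and_comm]
  · refine ⟨fun x => ⟨f x, hf x⟩, fun x C => ?_⟩
    rw [key x C.1 C.2, Subtype.ext_iff]

/-- A map all of whose fibres have `q` elements is, up to a bijection, a projection `W × Fin q →
W`. -/
theorem exists_equiv_prod_fin {V W : Type*} [Fintype V] [DecidableEq W] (F : V → W) {q : ℕ}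
    (hF : ∀ w, (Finset.univ.filter fun x => F x = w).card = q) :
    ∃ e : V ≃ W × Fin q, ∀ x, (e x).1 = F x := by
  have hcard : ∀ w, Fintype.card {x // F x = w} = q := fun w => by
    rw [Fintype.card_subtype, hF]
  refine ⟨(Equiv.sigmaFiberEquiv F).symm.trans
    ((Equiv.sigmaCongrRight fun w => Fintype.equivFinOfCardEq (hcard w)).trans
      (Equiv.sigmaEquivProd W (Fin q))), fun x => rfl⟩

theorem IsGridLike.nonempty_iso (h : IsGridLike Δ q M n) [Nonempty V] :
    Nonempty (Δ ≃g cliqueExtension q (gridGraph n n)) := by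
  obtain ⟨x₀⟩ := ‹Nonempty V›
  obtain ⟨A, B, hA, hB, nAB, hxA, hxB⟩ := h.exists_two_lines x₀
  have hAB : ¬ Disjoint A B := Finset.not_disjoint_iff.2 ⟨x₀, hxA, hxB⟩
  obtain ⟨cA, f, hf⟩ := h.exists_coordinate hA hB hAB nAB
  obtain ⟨cB, g, hg⟩ := h.exists_coordinate hB hA (fun hd => hAB hd.symm) nAB.symm
  let eA := Finset.equivFinOfCardEq cA
  let eB := Finset.equivFinOfCardEq cB
  obtain ⟨e, he⟩ := exists_equiv_prod_fin (fun x => (eA (f x), eB (g x))) (q := q) (by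
    rintro ⟨i, j⟩
    refine Eq.trans ?_
      (h.card_inter_eq_of_mem_parallelClass hA hB hAB nAB (eA.symm i).2 (eB.symm j).2)
    congr 1
    ext x
    rw [Finset.mem_filter, Finset.mem_inter, hf, hg, Prod.mk.injEq, Equiv.eq_symm_apply,
      Equiv.eq_symm_apply]
    simp)
  have hadj : ∀ x y, y ∈ closedNbhd Δ x ↔ f x = f y ∨ g x = g y := by
    intro x y
    have hne : (f x).1 ≠ (g x).1 := fun hcon =>
      h.not_mem_parallelClass_both hA hB hAB nAB (f x).2 (hcon ▸ (g x).2)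
    rw [h.closedNbhd_eq_union (mem_parallelClass.1 (f x).2).1 (mem_parallelClass.1 (g x).2).1 hne
      ((hf x _).2 rfl) ((hg x _).2 rfl), Finset.mem_union, hf, hg, eq_comm, eq_comm (a := g y)]
  refine ⟨⟨e, fun {x y} => ?_⟩⟩
  have h1 : (cliqueExtension q (gridGraph n n)).Adj (e x) (e y) ↔
      x ≠ y ∧ (f x = f y ∨ g x = g y) := by
    simp only [cliqueExtension, gridGraph, SimpleGraph.boxProd_adj, he, Prod.mk.injEq,
      SimpleGraph.top_adj, ne_eq, e.injective.eq_iff, eA.injective.eq_iff, eB.injective.eq_iff]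
    tauto
  rw [h1, ← hadj, mem_closedNbhd]
  constructor
  · rintro ⟨hne, h2⟩
    exact h2.resolve_left (Ne.symm hne)
  · exact fun h2 => ⟨h2.ne, Or.inr h2⟩

end Lines

/-! ### Gaussian numbers and the reconstruction of the grid -/

theorem gaussNumber_succ (q D : ℕ) : gaussNumber q (D + 1) = q * gaussNumber q D + 1 := by
  rw [gaussNumber, Finset.sum_range_succ', gaussNumber, Finset.mul_sum]
  simp [pow_succ']

theorem pow_le_gaussNumber_succ (q D : ℕ) : q ^ D ≤ gaussNumber q (D + 1) := by
  rw [gaussNumber, Finset.sum_range_succ]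
  omega

/-- The bound `χ(q)` on `D` enters the proof mainly through this inequality. -/
theorem eight_mul_pow_le_gaussNumber {q D : ℕ} (hq : 2 ≤ q) (hD : chiBound q ≤ D) :
    8 * q ^ 4 ≤ gaussNumber q D := by
  have h6 : 6 ≤ chiBound q := by
    unfold chiBound; split_ifs <;> omega
  obtain ⟨D, rfl⟩ : ∃ D', D = D' + 2 := ⟨D - 2, by omega⟩
  rcases lt_or_ge q 7 with h7 | h7
  · refine le_trans ?_ (pow_le_gaussNumber_succ q (D + 1))
    unfold chiBound at hD
    have hmono : ∀ k, k ≤ D + 1 → q ^ k ≤ q ^ (D + 1) := fun k hk =>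
      Nat.pow_le_pow_right (by omega) hk
    interval_cases q
    · exact le_trans (by norm_num) (hmono 8 (by simp at hD; omega))
    · exact le_trans (by norm_num) (hmono 7 (by simp at hD; omega))
    · exact le_trans (by norm_num) (hmono 6 (by simp at hD; omega))
    · exact le_trans (by norm_num) (hmono 6 (by simp at hD; omega))
    · exact le_trans (by norm_num) (hmono 6 (by simp at hD; omega))
  · rw [gaussNumber_succ]
    have h1 := pow_le_gaussNumber_succ q D
    have h2 : q ^ 4 ≤ q ^ D := Nat.pow_le_pow_right (by omega) (by omega)
    obtain ⟨D, rfl⟩ : ∃ D', D = D' + 1 := ⟨D - 1, by omega⟩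
    have h3 := pow_le_gaussNumber_succ q D
    have h4 : q ^ 3 ≤ q ^ D := Nat.pow_le_pow_right (by omega) (by omega)
    have h5 : q ^ (D + 1) + q ^ D ≤ gaussNumber q (D + 1 + 1) := by
      rw [gaussNumber, Finset.sum_range_succ, Finset.sum_range_succ]; omega
    have h6 : q * (q ^ 4 + q ^ 3) ≤ q * gaussNumber q (D + 1 + 1) :=
      Nat.mul_le_mul_left q (by omega)
    have h7' : q * (q ^ 4 + q ^ 3) = q * q ^ 4 + q ^ 4 := by ring
    have h8 : 7 * q ^ 4 ≤ q * q ^ 4 := Nat.mul_le_mul_right _ h7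
    omega

theorem mainTheorem5 {V : Type*} [Fintype V] (Δ : SimpleGraph V) (q D : ℕ) (hq : 2 ≤ q)
    (h_adj : ∀ y z : V, Δ.Adj y z →
      ((Δ.commonNeighbors y z).ncard : ℤ) ≡ (q : ℤ) - 2 [ZMOD (gaussNumber q (D - 1) : ℤ)])
    (h_nonadj : ∀ y z : V, y ≠ z → ¬ Δ.Adj y z → (Δ.commonNeighbors y z).ncard = 2 * q)
    (h_spec : IsCospectral Δ
      (cliqueExtension q (gridGraph (gaussNumber q D) (gaussNumber q D))))
    (hD : chiBound q ≤ D) :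
    Nonempty (Δ ≃g cliqueExtension q (gridGraph (gaussNumber q D) (gaussNumber q D))) := by
  have hbig := eight_mul_pow_le_gaussNumber hq hD
  have hn : gaussNumber q D = q * gaussNumber q (D - 1) + 1 := by
    have h6 : 6 ≤ chiBound q := by
      unfold chiBound; split_ifs <;> omega
    rw [← gaussNumber_succ, Nat.sub_add_cancel (by omega)]
  have hne : Nonempty V := by
    have h1 := h_spec.trace_identities.1
    rw [← Fintype.card_pos_iff]
    have h2 : 0 < gaussNumber q D := by omega
    have h3 : Fintype.card V = gaussNumber q D * gaussNumber q D * q := by exact_mod_cast h1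
    rw [h3]
    positivity
  exact (h_spec.isGridLike hq hn hbig h_adj h_nonadj).nonempty_iso
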